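/- Let $s\ge 1$ be an integer, $N\ge 2$ a real number, and let $\bm c^1,\dots,\bm c^s\in\mathbb Z^2$, $\bm c^n=(c^n_1,c^n_2)$, be such that - $c^n_1\neq 0$ and $c^n_2\ne 0$ for $1\le n\le s$; - $\dfrac{|c^n_2|}{|c^n_1|}\le \dfrac{1}{3^{s+2}s}$ for $1\le n\le s$; - $|c^n_i|<2^{-N}|c^{n+1}_i|$ for $1\le n\le s-1$ and $i\in\{1,2\}$. Then every $\bm q\in\mathbb Z^2$ has at most one representation $\bm q=\sum_{j=1}^s\zeta_j\bm c^j$ with $\zeta_j\in\{-1,0,1\}$. Let $\Lambda_s$ be the set of all $\bm q\ne 0$ having such a representation, and for $\bm q\in\Lambda_s$ let $\chi(\bm q)$ be the number of $j$ with $\zeta_j\ne 0$. Put $g(t)=\max\{1-|t|,0\}^2$ for $t\in\mathbb R$, $G(\bm\xi)=g(\xi_1)g(\xi_2)$ for $\bm\xi\in\mathbb R^2$, and, for an integer $\theta\ge1$, $$H^\theta(\bm\xi)=\sum_{\bm q\in\Lambda_s}2^{-\chi(\bm q)}\,G\bigl(2^\theta(\bm\xi-\bm q)\bigr),\qquad \bm\xi\in\mathbb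 R^2 .$$ There is an absolute constant $C$ such that for every $s\ge1$ there is an integer $\theta=\theta(s)\ge1$ such that, for all $N\ge2$ and all $\bm c^1,\dots,\bm c^s$ as above, the function $\frac{\xi_2}{\xi_1}H^\theta(\bm\xi)$ is integrable on $\mathbb R^2$, its inverse Fourier transform $\mathscr F^{-1}f(\bm x)=\int_{\mathbb R^2}f(\bm\xi)e^{2\pi i\langle \bm x,\bm\xi\rangle}\,d\bm\xi$ belongs to $L^1(\mathbb R^2)$, and $$\Bigl\|\mathscr F^{-1}\Bigl(\frac{\xi_2}{\xi_1}H^\theta\Bigr)\Bigr\|_{L^1(\mathbb R^2)}\le C .$$ -/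

import Mathlib

open MeasureTheory
open scoped FourierTransform

noncomputable section

namespace RieszBump

/-- The plane `ℝ²` with its Euclidean structure; `ξ 0`, `ξ 1` are the coordinates `ξ₁`, `ξ₂`. -/
abbrev Plane : Type := EuclideanSpace ℝ (Fin 2)

/-- A lattice point of `ℤ²`, seen in the plane. -/
def toPlane (q : Fin 2 → ℤ) : Plane := WithLp.toLp 2 fun i => (q i : ℝ)

/-- Conditions on the frequencies `c¹, …, cˢ ∈ ℤ²` (indexed here by `0, …, s - 1`). -/
structure Admissible (s : ℕ) (N : ℝ) (c : Fin s → Fin 2 → ℤ) : Prop where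
  /-- No frequency lies on a coordinate axis. -/
  off_axes : ∀ n i, c n i ≠ 0
  /-- The frequencies are concentrated near the first coordinate axis. -/
  slope : ∀ n, |(c n 1 : ℝ)| / |(c n 0 : ℝ)| ≤ 1 / (3 ^ (s + 2) * (s : ℝ))
  /-- Both coordinates are lacunary. -/
  lacunary : ∀ n m : Fin s, (m : ℕ) = (n : ℕ) + 1 →
    ∀ i, |(c n i : ℝ)| < (2 : ℝ) ^ (-N) * |(c m i : ℝ)|

/-- The combination `∑ ζⱼ cʲ` with coefficients `ζⱼ ∈ {-1, 0, 1}`. -/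
def comb {s : ℕ} (c : Fin s → Fin 2 → ℤ) (ζ : Fin s → SignType) : Fin 2 → ℤ :=
  ∑ j, (ζ j : ℤ) • c j

/-- The set `Λₛ` of all non-zero combinations `∑ ζⱼ cʲ`, `ζⱼ ∈ {-1, 0, 1}`. -/
def Lam {s : ℕ} (c : Fin s → Fin 2 → ℤ) : Finset (Fin 2 → ℤ) :=
  (Finset.univ.image (comb c)).erase 0

open Classical in
/-- The number `χ(q)` of non-zero coefficients in the representation `q = ∑ ζⱼ cʲ`
(which is unique for admissible frequencies). -/
def chi {s : ℕ} (c : Fin s → Fin 2 → ℤ) (q : Fin 2 → ℤ) : ℕ :=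
  if h : ∃ ζ, comb c ζ = q then (Finset.univ.filter fun j => h.choose j ≠ 0).card else 0

/-- `g(t) = max{1 - |t|, 0}²`. -/
def g (t : ℝ) : ℝ := (max (1 - |t|) 0) ^ 2

/-- `G(ξ) = g(ξ₁) g(ξ₂)`. -/
def G (ξ : Plane) : ℝ := g (ξ 0) * g (ξ 1)

/-- `H^θ(ξ) = ∑_{q ∈ Λₛ} 2^{-χ(q)} G(2^θ (ξ - q))`. -/
def H {s : ℕ} (c : Fin s → Fin 2 → ℤ) (θ : ℕ) (ξ : Plane) : ℝ :=
  ∑ q ∈ Lam c, 1 / 2 ^ chi c q * G ((2 : ℝ) ^ θ • (ξ - toPlane q))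

/-- The function `(ξ₂ / ξ₁) H^θ(ξ)`, with complex values. -/
def ratioH {s : ℕ} (c : Fin s → Fin 2 → ℤ) (θ : ℕ) (ξ : Plane) : ℂ :=
  ((ξ 1 / ξ 0 * H c θ ξ : ℝ) : ℂ)

end RieszBump

end

namespace RieszBump

/-! The choice `θ = 1` works for every `s`, and no cancellation between different `q` is needed.
Each term of the multiplier is a tensor product of a bump times `1/t` near `q 0` and a bump times
`t` near `q 1`. In one variable, a cut-off of a function bounded by `M` together with two
derivatives has an inverse Fourier transform of `L¹` norm at most `2πM`
(`integrable_fourierInv_cutoff`). The two factors therefore cost `O(1/|q 0|)` and `O(|q 1| + 1)`,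
and by Fubini the term costs a constant times `(|q 1| + 1)/|q 0|`.

By lacunarity `q` is dominated in both coordinates by its last frequency, so this quotient is
`O(3⁻ˢ)` (`Admissible.slope_le`). There are at most `3ˢ` terms with weights at most `1`, so the
triangle inequality gives an absolute constant. -/

/-! ### Oscillatory integrals on an interval. -/

open Complex in
/-- Integration by parts against the character `t ↦ exp (i y t)`. -/
lemma integral_mul_exp_eq {f f' : ℝ → ℂ} {a b y : ℝ} (hy : y ≠ 0)
    (hf : ∀ t ∈ Set.uIcc a b, HasDerivAt f (f' t) t) (hf' : ContinuousOn f' (Set.uIcc a b)) :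
    ∫ t in a..b, f t * exp ((y * t : ℝ) * I) =
      (f b * exp ((y * b : ℝ) * I) - f a * exp ((y * a : ℝ) * I)
        - ∫ t in a..b, f' t * exp ((y * t : ℝ) * I)) / (y * I) := by
  have hyI : (y * I : ℂ) ≠ 0 := mul_ne_zero (ofReal_ne_zero.mpr hy) I_ne_zero
  have hv : ∀ t ∈ Set.uIcc a b, HasDerivAt (fun t : ℝ => exp ((y * t : ℝ) * I))
      (exp ((y * t : ℝ) * I) * (y * I)) t := by
    intro t _
    have h1 : HasDerivAt (fun t : ℝ => y * t) y t := by simpa using (hasDerivAt_id t).const_mul y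
    exact (h1.ofReal_comp.mul_const I).cexp
  have key := intervalIntegral.integral_mul_deriv_eq_deriv_mul hf hv hf'.intervalIntegrable
    (Continuous.intervalIntegrable (by fun_prop) _ _)
  rw [eq_div_iff hyI, ← key, ← intervalIntegral.integral_mul_const]
  simp only [mul_assoc]

open Complex in
/-- First-order asymptotics of an oscillatory integral of a twice differentiable function. -/
lemma norm_integral_mul_exp_sub_le {f f' f'' : ℝ → ℝ} {a b y A B : ℝ} (hab : a ≤ b) (hy : y ≠ 0)
    (hf : ∀ t ∈ Set.Icc a b, HasDerivAt f (f' t) t)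
    (hf' : ∀ t ∈ Set.Icc a b, HasDerivAt f' (f'' t) t) (hf'' : ContinuousOn f'' (Set.Icc a b))
    (hA : ∀ t ∈ Set.Icc a b, |f' t| ≤ A) (hB : ∀ t ∈ Set.Icc a b, |f'' t| ≤ B) :
    ‖(∫ t in a..b, (f t : ℂ) * exp ((y * t : ℝ) * I)) -
        (f b * exp ((y * b : ℝ) * I) - f a * exp ((y * a : ℝ) * I)) / (y * I)‖
      ≤ (2 * A + B * (b - a)) / y ^ 2 := by
  have hu : Set.uIcc a b = Set.Icc a b := Set.uIcc_of_le hab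
  have c' : ContinuousOn f' (Set.Icc a b) := fun t ht => (hf' t ht).continuousAt.continuousWithinAt
  have e1 := integral_mul_exp_eq (f := fun t => (f t : ℂ)) (f' := fun t => (f' t : ℂ)) hy
    (fun t ht => (hf t (hu ▸ ht)).ofReal_comp)
    (hu ▸ continuous_ofReal.comp_continuousOn c')
  have e2 := integral_mul_exp_eq (f := fun t => (f' t : ℂ)) (f' := fun t => (f'' t : ℂ)) hy
    (fun t ht => (hf' t (hu ▸ ht)).ofReal_comp)
    (hu ▸ continuous_ofReal.comp_continuousOn hf'')
  have hI : ‖∫ t in a..b, (f'' t : ℂ) * exp ((y * t : ℝ) * I)‖ ≤ B * (b - a) := by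
    have := intervalIntegral.norm_integral_le_of_norm_le_const (a := a) (b := b) (C := B)
      (f := fun t : ℝ => (f'' t : ℂ) * exp ((y * t : ℝ) * I)) (fun t ht => by
        rw [norm_mul, norm_exp_ofReal_mul_I, mul_one, norm_real]
        exact hB t (Set.Ioc_subset_Icc_self (Set.uIoc_of_le hab ▸ ht)))
    rwa [abs_of_nonneg (sub_nonneg.mpr hab)] at this
  have hbd : ∀ t ∈ Set.Icc a b, ‖(f' t : ℂ) * exp ((y * t : ℝ) * I)‖ ≤ A := fun t ht => by
    rw [norm_mul, norm_exp_ofReal_mul_I, mul_one, norm_real]; exact hA t ht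
  have hb := hbd b (Set.right_mem_Icc.mpr hab)
  have ha := hbd a (Set.left_mem_Icc.mpr hab)
  -- The second integration by parts leaves only boundary values of `f'` and the integral of `f''`,
  -- all divided by `y ^ 2`.
  rw [e1, e2, ← sub_div, sub_sub_cancel_left, norm_div, norm_neg, norm_div, norm_mul, norm_I,
    mul_one, norm_real, Real.norm_eq_abs, div_div, abs_mul_abs_self, ← sq]
  gcongr
  refine (norm_sub_le _ _).trans (add_le_add ((norm_sub_le _ _).trans ?_) hI)
  linarith

/-! ### The bump and one-dimensional cut-offs. -/

lemma g_nonneg (t : ℝ) : 0 ≤ g t := sq_nonneg _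

lemma g_le_one (t : ℝ) : g t ≤ 1 := by
  have h : max (1 - |t|) 0 ≤ 1 := max_le (by linarith [abs_nonneg t]) zero_le_one
  exact pow_le_one₀ (le_max_right _ _) h

lemma g_eq_zero {t : ℝ} (h : 1 ≤ |t|) : g t = 0 := by
  simp [g, max_eq_right (sub_nonpos.mpr h)]

lemma g_of_nonneg {t : ℝ} (h0 : 0 ≤ t) (h1 : t ≤ 1) : g t = (1 - t) ^ 2 := by
  rw [g, abs_of_nonneg h0, max_eq_left (by linarith)]

lemma g_of_nonpos {t : ℝ} (h0 : t ≤ 0) (h1 : -1 ≤ t) : g t = (1 + t) ^ 2 := by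
  rw [g, abs_of_nonpos h0, max_eq_left (by linarith), sub_neg_eq_add]

lemma continuous_g : Continuous g := by unfold g; fun_prop

/-- The bump `g (2 (t - q))` cut out of the function `φ`. -/
def cutoff (φ : ℝ → ℝ) (q t : ℝ) : ℂ := ((φ t * g (2 * (t - q)) : ℝ) : ℂ)

lemma cutoff_eq_zero (φ : ℝ → ℝ) {q t : ℝ} (ht : t ∉ Set.Ioc (q - 1 / 2) (q + 1 / 2)) :
    cutoff φ q t = 0 := by
  have : 1 ≤ |2 * (t - q)| := by
    by_contra! h
    rw [abs_lt] at h
    exact ht ⟨by linarith, by linarith⟩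
  simp [cutoff, g_eq_zero this]

section Cutoff

variable {φ φ' φ'' : ℝ → ℝ} {q M : ℝ}

lemma integrable_cutoff (hφ : ContinuousOn φ (Set.Icc (q - 1 / 2) (q + 1 / 2))) :
    Integrable (cutoff φ q) := by
  rw [← integrableOn_iff_integrable_of_support_subset (s := Set.Icc (q - 1 / 2) (q + 1 / 2))]
  · refine ContinuousOn.integrableOn_compact isCompact_Icc ?_
    exact Complex.continuous_ofReal.comp_continuousOn
      (hφ.mul (continuous_g.comp (by fun_prop)).continuousOn)
  · intro t ht
    by_contra h
    exact ht (cutoff_eq_zero φ fun h' => h (Set.Ioc_subset_Icc_self h'))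

lemma norm_cutoff_le (h0 : ∀ t ∈ Set.Icc (q - 1 / 2) (q + 1 / 2), |φ t| ≤ M) {t : ℝ}
    (ht : t ∈ Set.Icc (q - 1 / 2) (q + 1 / 2)) : ‖cutoff φ q t‖ ≤ M := by
  rw [cutoff, Complex.norm_real, Real.norm_eq_abs, abs_mul, abs_of_nonneg (g_nonneg _)]
  exact (mul_le_of_le_one_right (abs_nonneg _) (g_le_one _)).trans (h0 t ht)

open Complex in
lemma fourierInv_cutoff_eq (φ : ℝ → ℝ) (q x : ℝ) :
    𝓕⁻ (cutoff φ q) x =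
      ∫ t in (q - 1 / 2)..(q + 1 / 2), cutoff φ q t * exp ((2 * Real.pi * x * t : ℝ) * I) := by
  rw [Real.fourierInv_eq', intervalIntegral.integral_of_le (by linarith),
    setIntegral_eq_integral_of_forall_compl_eq_zero
      (fun t ht => by rw [cutoff_eq_zero φ ht, zero_mul])]
  refine integral_congr_ae (Filter.Eventually.of_forall fun t => ?_)
  simp only [smul_eq_mul, RCLike.inner_apply, conj_trivial]
  rw [mul_comm, mul_assoc (2 * Real.pi)]

lemma norm_fourierInv_cutoff_le (h0 : ∀ t ∈ Set.Icc (q - 1 / 2) (q + 1 / 2), |φ t| ≤ M) (x : ℝ) :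
    ‖𝓕⁻ (cutoff φ q) x‖ ≤ M := by
  rw [fourierInv_cutoff_eq]
  refine (intervalIntegral.norm_integral_le_of_norm_le_const (C := M) fun t ht => ?_).trans ?_
  · rw [norm_mul, Complex.norm_exp_ofReal_mul_I, mul_one]
    rw [Set.uIoc_of_le (by linarith)] at ht
    exact norm_cutoff_le h0 (Set.Ioc_subset_Icc_self ht)
  · rw [show q + 1 / 2 - (q - 1 / 2) = 1 by ring, abs_one, mul_one]

open Complex in
/-- One half of the estimate for a cut-off function: `σ = 1` is the right half of the bump and
`σ = -1` the left half. -/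
lemma norm_integral_mul_sq_mul_exp_sub_le {a b y σ : ℝ} (hab : a ≤ b) (hba : b - a ≤ 1 / 2)
    (hy : y ≠ 0) (hσ : |σ| = 1) (hM : 0 ≤ M) (hP : ∀ t ∈ Set.Icc a b, |1 - σ * (2 * (t - q))| ≤ 1)
    (h1 : ∀ t ∈ Set.Icc a b, HasDerivAt φ (φ' t) t)
    (h2 : ∀ t ∈ Set.Icc a b, HasDerivAt φ' (φ'' t) t) (h3 : ContinuousOn φ'' (Set.Icc a b))
    (b0 : ∀ t ∈ Set.Icc a b, |φ t| ≤ M) (b1 : ∀ t ∈ Set.Icc a b, |φ' t| ≤ M)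
    (b2 : ∀ t ∈ Set.Icc a b, |φ'' t| ≤ M) :
    ‖(∫ t in a..b, ((φ t * (1 - σ * (2 * (t - q))) ^ 2 : ℝ) : ℂ) * exp ((y * t : ℝ) * I)) -
        ((φ b * (1 - σ * (2 * (b - q))) ^ 2 : ℝ) * exp ((y * b : ℝ) * I)
          - (φ a * (1 - σ * (2 * (a - q))) ^ 2 : ℝ) * exp ((y * a : ℝ) * I)) / (y * I)‖
      ≤ 19 * M / y ^ 2 := by
  have hσ2 : σ ^ 2 = 1 := by rw [← sq_abs, hσ, one_pow]
  have hl : ∀ t, HasDerivAt (fun t : ℝ => 1 - σ * (2 * (t - q))) (-(2 * σ)) t := fun t => by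
    have := ((((hasDerivAt_id t).sub_const q).const_mul 2).const_mul σ).const_sub 1
    convert! this using 1; ring
  have hP2 : ∀ t ∈ Set.Icc a b, |(1 - σ * (2 * (t - q))) ^ 2| ≤ 1 := fun t ht => by
    rw [abs_pow]; exact pow_le_one₀ (abs_nonneg _) (hP t ht)
  have hP1 : ∀ t ∈ Set.Icc a b, |4 * σ * (1 - σ * (2 * (t - q)))| ≤ 4 := fun t ht => by
    rw [abs_mul, abs_mul, hσ, abs_of_pos (by norm_num : (0 : ℝ) < 4)]
    linarith [hP t ht]
  have prod_le : ∀ {u v U V : ℝ}, |u| ≤ U → |v| ≤ V → |u * v| ≤ U * V := fun hu hv => by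
    rw [abs_mul]; exact mul_le_mul hu hv (abs_nonneg _) ((abs_nonneg _).trans hu)
  -- By the product rule `5 = 1 + 4` and `17 = 1 + 2 * 4 + 8`; on length at most `1/2` the total is
  -- `10 + 17/2 ≤ 19`.
  refine (norm_integral_mul_exp_sub_le (y := y) (A := 5 * M) (B := 17 * M)
    (f := fun t => φ t * (1 - σ * (2 * (t - q))) ^ 2)
    (f' := fun t => φ' t * (1 - σ * (2 * (t - q))) ^ 2 - φ t * (4 * σ * (1 - σ * (2 * (t - q)))))
    (f'' := fun t => φ'' t * (1 - σ * (2 * (t - q))) ^ 2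
      - 2 * (φ' t * (4 * σ * (1 - σ * (2 * (t - q))))) + 8 * φ t)
    hab hy ?_ ?_ ?_ ?_ ?_).trans ?_
  · intro t ht
    convert! (h1 t ht).mul ((hl t).pow 2) using 1
    simp only [Pi.pow_apply]; push_cast; ring
  · intro t ht
    convert! ((h2 t ht).mul ((hl t).pow 2)).sub ((h1 t ht).mul ((hl t).const_mul (4 * σ))) using 1
    simp only [Pi.pow_apply]; push_cast; linear_combination (-8 * φ t) * hσ2
  · have c0 : ContinuousOn φ (Set.Icc a b) := fun t ht => (h1 t ht).continuousAt.continuousWithinAt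
    have c1 : ContinuousOn φ' (Set.Icc a b) := fun t ht => (h2 t ht).continuousAt.continuousWithinAt
    fun_prop
  · intro t ht
    have k1 := prod_le (b1 t ht) (hP2 t ht)
    have k2 := prod_le (b0 t ht) (hP1 t ht)
    refine (abs_sub _ _).trans ?_
    linarith
  · intro t ht
    have k1 := prod_le (b2 t ht) (hP2 t ht)
    have k2 := prod_le (b1 t ht) (hP1 t ht)
    have k3 := b0 t ht
    rw [abs_le] at k1 k2 k3 ⊢
    constructor <;> linarith
  · gcongr
    nlinarith

/-- A cut-off of a twice continuously differentiable function has a Fourier transform of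
quadratic decay. -/
lemma norm_fourierInv_cutoff_le_div
    (h1 : ∀ t ∈ Set.Icc (q - 1 / 2) (q + 1 / 2), HasDerivAt φ (φ' t) t)
    (h2 : ∀ t ∈ Set.Icc (q - 1 / 2) (q + 1 / 2), HasDerivAt φ' (φ'' t) t)
    (h3 : ContinuousOn φ'' (Set.Icc (q - 1 / 2) (q + 1 / 2)))
    (b0 : ∀ t ∈ Set.Icc (q - 1 / 2) (q + 1 / 2), |φ t| ≤ M)
    (b1 : ∀ t ∈ Set.Icc (q - 1 / 2) (q + 1 / 2), |φ' t| ≤ M)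
    (b2 : ∀ t ∈ Set.Icc (q - 1 / 2) (q + 1 / 2), |φ'' t| ≤ M) {x : ℝ} (hx : x ≠ 0) :
    ‖𝓕⁻ (cutoff φ q) x‖ ≤ 38 * M / (2 * Real.pi * x) ^ 2 := by
  have hM : 0 ≤ M := (abs_nonneg _).trans (b0 q ⟨by linarith, by linarith⟩)
  have hy : 2 * Real.pi * x ≠ 0 := mul_ne_zero (by positivity) hx
  have sL : Set.Icc (q - 1 / 2) q ⊆ Set.Icc (q - 1 / 2) (q + 1 / 2) :=
    Set.Icc_subset_Icc_right (by linarith)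
  have sR : Set.Icc q (q + 1 / 2) ⊆ Set.Icc (q - 1 / 2) (q + 1 / 2) :=
    Set.Icc_subset_Icc_left (by linarith)
  have kL := norm_integral_mul_sq_mul_exp_sub_le (q := q) (σ := -1) (a := q - 1 / 2) (b := q)
    (by linarith) (by linarith) hy (by simp) hM
    (fun t ht => abs_le.mpr ⟨by linarith [ht.1, ht.2], by linarith [ht.1, ht.2]⟩)
    (fun t ht => h1 t (sL ht)) (fun t ht => h2 t (sL ht)) (h3.mono sL)
    (fun t ht => b0 t (sL ht)) (fun t ht => b1 t (sL ht)) (fun t ht => b2 t (sL ht))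
  have kR := norm_integral_mul_sq_mul_exp_sub_le (q := q) (σ := 1) (a := q) (b := q + 1 / 2)
    (by linarith) (by linarith) hy (by simp) hM
    (fun t ht => abs_le.mpr ⟨by linarith [ht.1, ht.2], by linarith [ht.1, ht.2]⟩)
    (fun t ht => h1 t (sR ht)) (fun t ht => h2 t (sR ht)) (h3.mono sR)
    (fun t ht => b0 t (sR ht)) (fun t ht => b1 t (sR ht)) (fun t ht => b2 t (sR ht))
  have hcont : ContinuousOn (fun t : ℝ => cutoff φ q t *
      Complex.exp ((2 * Real.pi * x * t : ℝ) * Complex.I))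
      (Set.Icc (q - 1 / 2) (q + 1 / 2)) := by
    have c0 : ContinuousOn φ (Set.Icc (q - 1 / 2) (q + 1 / 2)) :=
      fun t ht => (h1 t ht).continuousAt.continuousWithinAt
    exact (Complex.continuous_ofReal.comp_continuousOn
      (c0.mul (continuous_g.comp (by fun_prop)).continuousOn)).mul (by fun_prop)
  rw [fourierInv_cutoff_eq, ← intervalIntegral.integral_add_adjacent_intervals (b := q)
    ((hcont.mono sL).intervalIntegrable_of_Icc (by linarith))
    ((hcont.mono sR).intervalIntegrable_of_Icc (by linarith))]
  have eL : ∫ t in (q - 1 / 2)..q, cutoff φ q t *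
      Complex.exp ((2 * Real.pi * x * t : ℝ) * Complex.I) =
      ∫ t in (q - 1 / 2)..q, ((φ t * (1 - -1 * (2 * (t - q))) ^ 2 : ℝ) : ℂ) *
        Complex.exp ((2 * Real.pi * x * t : ℝ) * Complex.I) := by
    refine intervalIntegral.integral_congr fun t ht => ?_
    rw [Set.uIcc_of_le (by linarith)] at ht
    simp only [cutoff]
    rw [g_of_nonpos (by linarith [ht.2]) (by linarith [ht.1]), neg_one_mul, sub_neg_eq_add]
  have eR : ∫ t in q..(q + 1 / 2), cutoff φ q t *
      Complex.exp ((2 * Real.pi * x * t : ℝ) * Complex.I) =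
      ∫ t in q..(q + 1 / 2), ((φ t * (1 - 1 * (2 * (t - q))) ^ 2 : ℝ) : ℂ) *
        Complex.exp ((2 * Real.pi * x * t : ℝ) * Complex.I) := by
    refine intervalIntegral.integral_congr fun t ht => ?_
    rw [Set.uIcc_of_le (by linarith)] at ht
    simp only [cutoff]
    rw [g_of_nonneg (by linarith [ht.1]) (by linarith [ht.2]), one_mul]
  rw [eL, eR]
  -- The first-order terms vanish at the outer endpoints, and at `q` the two halves contribute
  -- opposite values. Only the quadratic remainders survive, despite the corner of `g` at its peak.
  have v1 : φ (q - 1 / 2) * (1 - -1 * (2 * (q - 1 / 2 - q))) ^ 2 = 0 := by ring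
  have v2 : φ (q + 1 / 2) * (1 - 1 * (2 * (q + 1 / 2 - q))) ^ 2 = 0 := by ring
  have v3 : φ q * (1 - -1 * (2 * (q - q))) ^ 2 = φ q := by ring
  have v4 : φ q * (1 - 1 * (2 * (q - q))) ^ 2 = φ q := by ring
  rw [v1, v3] at kL
  rw [v2, v4] at kR
  have := (norm_add_le _ _).trans (add_le_add kL kR)
  calc _ = _ := by congr 1; simp only [Complex.ofReal_zero]; ring
    _ ≤ _ := this
    _ = _ := by ring

/-- The `L¹` bound for the inverse Fourier transform of a cut-off function. -/
lemma integrable_fourierInv_cutoff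
    (h1 : ∀ t ∈ Set.Icc (q - 1 / 2) (q + 1 / 2), HasDerivAt φ (φ' t) t)
    (h2 : ∀ t ∈ Set.Icc (q - 1 / 2) (q + 1 / 2), HasDerivAt φ' (φ'' t) t)
    (h3 : ContinuousOn φ'' (Set.Icc (q - 1 / 2) (q + 1 / 2)))
    (b0 : ∀ t ∈ Set.Icc (q - 1 / 2) (q + 1 / 2), |φ t| ≤ M)
    (b1 : ∀ t ∈ Set.Icc (q - 1 / 2) (q + 1 / 2), |φ' t| ≤ M)
    (b2 : ∀ t ∈ Set.Icc (q - 1 / 2) (q + 1 / 2), |φ'' t| ≤ M) :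
    Integrable (cutoff φ q) ∧ Integrable (𝓕⁻ (cutoff φ q)) ∧
      ∫ x, ‖𝓕⁻ (cutoff φ q) x‖ ≤ 2 * Real.pi * M := by
  have hM : 0 ≤ M := (abs_nonneg _).trans (b0 q ⟨by linarith, by linarith⟩)
  have hint : Integrable (cutoff φ q) :=
    integrable_cutoff fun t ht => (h1 t ht).continuousAt.continuousWithinAt
  have hcont : Continuous (𝓕⁻ (cutoff φ q)) := by
    have : Continuous (𝓕 (cutoff φ q)) :=
      VectorFourier.fourierIntegral_continuous Real.continuous_fourierChar
        (by fun_prop) hint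
    have e : 𝓕⁻ (cutoff φ q) = fun x => 𝓕 (cutoff φ q) (-x) :=
      funext fun x => Real.fourierInv_eq_fourier_neg _ x
    rw [e]
    exact this.comp continuous_neg
  have hbd : ∀ x : ℝ, ‖𝓕⁻ (cutoff φ q) x‖ ≤ 2 * M * (1 + x ^ 2)⁻¹ := by
    intro x
    have k0 := norm_fourierInv_cutoff_le b0 x
    -- The uniform bound `M` and the decay `M / x ^ 2` add up to `2 * M`; the latter uses `38 ≤
    -- (2π)²`.
    rw [← div_eq_mul_inv, le_div_iff₀ (by positivity)]
    rcases eq_or_ne x 0 with rfl | hx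
    · linarith
    · have k1 := norm_fourierInv_cutoff_le_div h1 h2 h3 b0 b1 b2 hx
      rw [le_div_iff₀ (by positivity)] at k1
      have hpi' : 38 ≤ (2 * Real.pi) ^ 2 := by nlinarith [Real.pi_gt_d2]
      have k2 : ‖𝓕⁻ (cutoff φ q) x‖ * x ^ 2 ≤ M := by
        have k3 : 38 * (‖𝓕⁻ (cutoff φ q) x‖ * x ^ 2)
            ≤ (2 * Real.pi) ^ 2 * (‖𝓕⁻ (cutoff φ q) x‖ * x ^ 2) := by gcongr
        nlinarith
      linarith
  have hdom : Integrable fun x : ℝ => 2 * M * (1 + x ^ 2)⁻¹ :=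
    integrable_inv_one_add_sq.const_mul _
  have hF : Integrable (𝓕⁻ (cutoff φ q)) :=
    hdom.mono' hcont.aestronglyMeasurable (Filter.Eventually.of_forall hbd)
  refine ⟨hint, hF, (integral_mono hF.norm hdom hbd).trans ?_⟩
  rw [integral_const_mul, integral_univ_inv_one_add_sq]
  linarith

end Cutoff


/-- The cut-off of the coordinate function. -/
lemma integrable_fourierInv_cutoff_id (q : ℝ) :
    Integrable (cutoff (fun t => t) q) ∧ Integrable (𝓕⁻ (cutoff (fun t => t) q)) ∧
      ∫ x, ‖𝓕⁻ (cutoff (fun t => t) q) x‖ ≤ 2 * Real.pi * (|q| + 1) := by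
  refine integrable_fourierInv_cutoff (φ' := fun _ => 1) (φ'' := fun _ => 0)
    (fun t _ => hasDerivAt_id t) (fun t _ => hasDerivAt_const t 1) continuousOn_const
    (fun t ht => ?_) (fun t _ => ?_) (fun t _ => ?_)
  · exact abs_le.mpr ⟨by linarith [ht.1, neg_abs_le q], by linarith [ht.2, le_abs_self q]⟩
  · rw [abs_one]; linarith [abs_nonneg q]
  · rw [abs_zero]; linarith [abs_nonneg q]

/-- The cut-off of the reciprocal, away from the origin. -/
lemma integrable_fourierInv_cutoff_inv {q : ℝ} (hq : 1 ≤ |q|) :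
    Integrable (cutoff (fun t => t⁻¹) q) ∧ Integrable (𝓕⁻ (cutoff (fun t => t⁻¹) q)) ∧
      ∫ x, ‖𝓕⁻ (cutoff (fun t => t⁻¹) q) x‖ ≤ 2 * Real.pi * (16 / |q|) := by
  have hlow : ∀ t ∈ Set.Icc (q - 1 / 2) (q + 1 / 2), |q| / 2 ≤ |t| := fun t ht => by
    have h1 : |q - t| ≤ 1 / 2 := abs_le.mpr ⟨by linarith [ht.2], by linarith [ht.1]⟩
    linarith [abs_sub_abs_le_abs_sub q t]
  have hne : ∀ t ∈ Set.Icc (q - 1 / 2) (q + 1 / 2), t ≠ 0 := fun t ht =>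
    abs_pos.mp (by linarith [hlow t ht])
  have hinv : ∀ t ∈ Set.Icc (q - 1 / 2) (q + 1 / 2), |t⁻¹| ≤ 2 / |q| := fun t ht => by
    rw [abs_inv, ← inv_div]
    exact inv_anti₀ (by linarith) (hlow t ht)
  -- All but one factor of `2 / |q|` are replaced by `2`; the second derivative is the worst case,
  -- giving `2 * 2 ^ 2 * (2 / |q|) = 16 / |q|`.
  have hle : 2 / |q| ≤ 2 := div_le_self zero_le_two hq
  have h16 : 16 / |q| = 8 * (2 / |q|) := by ring
  have hpos : 0 < 2 / |q| := by positivity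
  refine integrable_fourierInv_cutoff (φ' := fun t => -(t⁻¹) ^ 2) (φ'' := fun t => 2 * (t⁻¹) ^ 3)
    (fun t ht => ?_) (fun t ht => ?_) ?_ (fun t ht => ?_) (fun t ht => ?_) (fun t ht => ?_)
  · convert! hasDerivAt_inv (hne t ht) using 1
    rw [inv_pow]
  · convert! ((hasDerivAt_inv (hne t ht)).pow 2).neg using 1
    push_cast; ring
  · exact ((continuousOn_inv₀.mono fun t ht => hne t ht).pow 3).const_mul 2 |>.congr
      fun t _ => rfl
  · linarith [hinv t ht]
  · rw [abs_neg, abs_pow, h16]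
    have := hinv t ht
    nlinarith [abs_nonneg t⁻¹]
  · rw [abs_mul, abs_pow, h16, abs_two]
    have h := hinv t ht
    have h3 : |t⁻¹| ^ 3 ≤ (2 / |q|) ^ 3 := pow_le_pow_left₀ (abs_nonneg _) h 3
    have h2 : (2 / |q|) ^ 2 ≤ 4 := by nlinarith
    nlinarith

/-! ### Tensor products and finite sums. -/

section Tensor

variable {ι : Type*} [Fintype ι] {f : ι → ℝ → ℂ}

lemma integrable_prod_coord (hf : ∀ i, Integrable (f i)) :
    Integrable fun ξ : EuclideanSpace ℝ ι => ∏ i, f i (ξ i) :=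
  (PiLp.volume_preserving_ofLp ι).integrable_comp_of_integrable (Integrable.fintype_prod hf)

lemma integral_prod_coord {𝕜 : Type*} [RCLike 𝕜] (f : ι → ℝ → 𝕜) :
    ∫ ξ : EuclideanSpace ℝ ι, ∏ i, f i (ξ i) = ∏ i, ∫ t, f i t := by
  rw [← integral_fintype_prod_volume_eq_prod,
    ← (EuclideanSpace.volume_preserving_symm_measurableEquiv_toLp ι).integral_comp']
  rfl

/-- The inverse Fourier transform of a tensor product. -/
lemma fourierInv_prod_coord (f : ι → ℝ → ℂ) (x : EuclideanSpace ℝ ι) :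
    𝓕⁻ (fun ξ : EuclideanSpace ℝ ι => ∏ i, f i (ξ i)) x = ∏ i, 𝓕⁻ (f i) (x i) := by
  simp only [Real.fourierInv_eq']
  rw [← integral_prod_coord]
  refine integral_congr_ae (Filter.Eventually.of_forall fun ξ => ?_)
  simp only [smul_eq_mul, Finset.prod_mul_distrib, ← Complex.exp_sum, PiLp.inner_apply]
  congr 2
  rw [← Finset.sum_mul, ← Complex.ofReal_sum, Finset.mul_sum]

lemma integrable_fourierInv_prod_coord (hf : ∀ i, Integrable (𝓕⁻ (f i))) :
    Integrable (𝓕⁻ (fun ξ : EuclideanSpace ℝ ι => ∏ i, f i (ξ i))) := by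
  rw [funext (fourierInv_prod_coord f)]
  exact integrable_prod_coord hf

lemma integral_norm_fourierInv_prod_coord (f : ι → ℝ → ℂ) :
    ∫ x, ‖𝓕⁻ (fun ξ : EuclideanSpace ℝ ι => ∏ i, f i (ξ i)) x‖ = ∏ i, ∫ t, ‖𝓕⁻ (f i) t‖ := by
  simp only [fourierInv_prod_coord, norm_prod]
  exact integral_prod_coord fun i t => ‖𝓕⁻ (f i) t‖

end Tensor

/-- The `L¹` norm of the inverse Fourier transform of a weighted sum. -/
lemma integral_norm_fourierInv_sum_le {V ι : Type*} [NormedAddCommGroup V] [InnerProductSpace ℝ V]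
    [MeasurableSpace V] [BorelSpace V] [FiniteDimensional ℝ V] {S : Finset ι} {w : ι → ℂ}
    {F : ι → V → ℂ} {B : ℝ} (hw : ∀ q ∈ S, ‖w q‖ ≤ 1) (hF : ∀ q ∈ S, Integrable (F q))
    (hF' : ∀ q ∈ S, Integrable (𝓕⁻ (F q))) (hB : ∀ q ∈ S, ∫ x, ‖𝓕⁻ (F q) x‖ ≤ B) :
    Integrable (fun ξ => ∑ q ∈ S, w q * F q ξ) ∧
      Integrable (𝓕⁻ fun ξ => ∑ q ∈ S, w q * F q ξ) ∧
      ∫ x, ‖𝓕⁻ (fun ξ => ∑ q ∈ S, w q * F q ξ) x‖ ≤ S.card * B := by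
  have e : 𝓕⁻ (fun ξ => ∑ q ∈ S, w q * F q ξ) = fun x => ∑ q ∈ S, w q * 𝓕⁻ (F q) x := by
    funext x
    simp only [Real.fourierInv_eq, Finset.smul_sum]
    rw [integral_finsetSum]
    · refine Finset.sum_congr rfl fun q _ => ?_
      rw [← integral_const_mul]
      simp only [Circle.smul_def, smul_eq_mul, mul_left_comm]
    · intro q hq
      have := (Real.fourierIntegral_convergent_iff (-x)).2 ((hF q hq).const_mul (w q))
      simpa using this
  have hI : Integrable fun x => ∑ q ∈ S, w q * 𝓕⁻ (F q) x :=
    integrable_finsetSum _ fun q hq => (hF' q hq).const_mul _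
  refine ⟨integrable_finsetSum _ fun q hq => (hF q hq).const_mul _, e ▸ hI, ?_⟩
  rw [e]
  calc ∫ x, ‖∑ q ∈ S, w q * 𝓕⁻ (F q) x‖ ≤ ∫ x, ∑ q ∈ S, ‖𝓕⁻ (F q) x‖ := by
        refine integral_mono hI.norm (integrable_finsetSum _ fun q hq => (hF' q hq).norm)
          fun x => norm_sum_le_of_le _ fun q hq => ?_
        rw [norm_mul]
        exact mul_le_of_le_one_left (norm_nonneg _) (hw q hq)
    _ = ∑ q ∈ S, ∫ x, ‖𝓕⁻ (F q) x‖ := integral_finsetSum _ fun q hq => (hF' q hq).norm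
    _ ≤ S.card * B := by
        rw [← nsmul_eq_mul]
        exact Finset.sum_le_card_nsmul _ _ _ hB

/-! ### Lacunary frequencies: slope and number of lattice points. -/

/-- In a sequence growing by factors of at least `4`, each term dominates the earlier ones. -/
lemma sum_Iio_le_third {s : ℕ} {d : Fin s → ℝ} (hd : ∀ n, 0 ≤ d n)
    (h : ∀ n m : Fin s, (m : ℕ) = (n : ℕ) + 1 → 4 * d n ≤ d m) (j : Fin s) :
    ∑ i ∈ Finset.Iio j, d i ≤ d j / 3 := by
  obtain ⟨k, hk⟩ := j
  induction k with
  | zero =>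
    have : Finset.Iio (⟨0, hk⟩ : Fin s) = ∅ := by
      ext i; simp [Fin.lt_def]
    rw [this, Finset.sum_empty]
    linarith [hd ⟨0, hk⟩]
  | succ k ih =>
    have hk' : k < s := by omega
    have : Finset.Iio (⟨k + 1, hk⟩ : Fin s) = insert ⟨k, hk'⟩ (Finset.Iio ⟨k, hk'⟩) := by
      ext i
      simp only [Finset.mem_Iio, Finset.mem_insert, Fin.lt_def, Fin.ext_iff]
      omega
    rw [this, Finset.sum_insert (by simp)]
    -- The ratio `1/3` reproduces itself: `d k + d k / 3 = 4 * d k / 3 ≤ d (k + 1) / 3`.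
    linarith [ih hk', h ⟨k, hk'⟩ ⟨k + 1, hk⟩ rfl]

section Frequencies

variable {s : ℕ} {N : ℝ} {c : Fin s → Fin 2 → ℤ}

lemma Admissible.four_mul_le (hc : Admissible s N c) (hN : 2 ≤ N) (i : Fin 2) (n m : Fin s)
    (h : (m : ℕ) = (n : ℕ) + 1) : 4 * |(c n i : ℝ)| ≤ |(c m i : ℝ)| := by
  have h1 := hc.lacunary n m h i
  have h2 : (2 : ℝ) ^ (-N) ≤ 1 / 4 := by
    calc (2 : ℝ) ^ (-N) ≤ (2 : ℝ) ^ (-2 : ℝ) :=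
          Real.rpow_le_rpow_of_exponent_le one_le_two (by linarith)
      _ = 1 / 4 := by rw [Real.rpow_neg zero_le_two]; norm_num
  nlinarith [abs_nonneg (c m i : ℝ)]

/-- A combination of the frequencies is dominated by its last term. -/
lemma Admissible.abs_comb_sub_le (hc : Admissible s N c) (hN : 2 ≤ N) {ζ : Fin s → SignType}
    {j : Fin s} (hj : ∀ i, j < i → ζ i = 0) (k : Fin 2) :
    |(comb c ζ k : ℝ) - ((ζ j : ℤ) : ℝ) * c j k| ≤ |(c j k : ℝ)| / 3 := by
  have e : (comb c ζ k : ℝ) = ∑ i, ((ζ i : ℤ) : ℝ) * c i k := by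
    simp only [comb, Finset.sum_apply, Pi.smul_apply, smul_eq_mul, Int.cast_sum, Int.cast_mul]
  have e2 : ∑ i, ((ζ i : ℤ) : ℝ) * c i k = ∑ i ∈ Finset.Iic j, ((ζ i : ℤ) : ℝ) * c i k := by
    refine (Finset.sum_subset (Finset.subset_univ _) fun i _ hi => ?_).symm
    rw [hj i (by simpa using hi)]; simp
  have e3 : Finset.Iic j = insert j (Finset.Iio j) := (Finset.Iio_insert j).symm
  rw [e, e2, e3, Finset.sum_insert (by simp), add_sub_cancel_left]
  refine le_trans ?_ (sum_Iio_le_third (d := fun i => |(c i k : ℝ)|) (fun _ => abs_nonneg _)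
    (hc.four_mul_le hN k) j)
  refine (Finset.abs_sum_le_sum_abs _ _).trans (Finset.sum_le_sum fun i _ => ?_)
  rw [abs_mul]
  refine mul_le_of_le_one_left (abs_nonneg _) ?_
  rcases ζ i with _ | _ | _ <;> simp

/-- The elements of `Λₛ` lie off the second coordinate axis and have small slope. -/
lemma Admissible.slope_le (hc : Admissible s N c) (hN : 2 ≤ N) {q : Fin 2 → ℤ} (hq : q ∈ Lam c) :
    1 ≤ |(q 0 : ℝ)| ∧ (|(q 1 : ℝ)| + 1) / |(q 0 : ℝ)| ≤ 7 / 2 / 3 ^ s := by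
  obtain ⟨hq0, hq⟩ := Finset.mem_erase.mp hq
  obtain ⟨ζ, -, rfl⟩ := Finset.mem_image.mp hq
  have hne : (Finset.univ.filter fun i => ζ i ≠ 0).Nonempty := by
    by_contra h
    rw [Finset.not_nonempty_iff_eq_empty, Finset.filter_eq_empty_iff] at h
    refine hq0 (Finset.sum_eq_zero fun i hi => ?_)
    rw [not_not.mp (h hi)]; simp
  -- The last active index `j` governs both coordinates at once, so the slope of `q` is comparable
  -- to that of `c j`.
  obtain ⟨j, hj, hmax⟩ := Finset.exists_max_image _ id hne
  have hj0 : ζ j ≠ 0 := (Finset.mem_filter.mp hj).2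
  have hjmax : ∀ i, j < i → ζ i = 0 := fun i hi => by
    by_contra h
    exact absurd (hmax i (by simpa using h)) (not_le.mpr hi)
  have hζ : |((ζ j : ℤ) : ℝ)| = 1 := by
    rcases h : ζ j with _ | _ | _
    · exact absurd h hj0
    · simp
    · simp
  have key := hc.abs_comb_sub_le hN hjmax
  have hlow : 2 / 3 * |(c j 0 : ℝ)| ≤ |(comb c ζ 0 : ℝ)| := by
    have h1 := abs_sub_abs_le_abs_sub (((ζ j : ℤ) : ℝ) * c j 0) (comb c ζ 0 : ℝ)
    rw [abs_sub_comm, abs_mul, hζ, one_mul] at h1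
    linarith [key 0]
  have hup : |(comb c ζ 1 : ℝ)| ≤ 4 / 3 * |(c j 1 : ℝ)| := by
    have h1 := abs_sub_abs_le_abs_sub (comb c ζ 1 : ℝ) (((ζ j : ℤ) : ℝ) * c j 1)
    rw [abs_mul, hζ, one_mul] at h1
    linarith [key 1]
  have hc1 : ∀ i, 1 ≤ |(c j i : ℝ)| := fun i => by
    exact_mod_cast Int.one_le_abs (hc.off_axes j i)
  have hpos : 0 < |(comb c ζ 0 : ℝ)| := by linarith [hc1 0]
  refine ⟨?_, ?_⟩
  · have : comb c ζ 0 ≠ 0 := fun h => by simp [h] at hpos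
    exact_mod_cast Int.one_le_abs this
  · have hs : (1 : ℝ) ≤ s := by
      exact_mod_cast (Nat.succ_le_of_lt (Nat.zero_lt_of_lt j.isLt))
    have hsl : |(c j 1 : ℝ)| / |(c j 0 : ℝ)| ≤ 1 / 3 ^ s := by
      refine (hc.slope j).trans (one_div_le_one_div_of_le (by positivity) ?_)
      have : (0 : ℝ) < 3 ^ s := by positivity
      rw [pow_add]
      nlinarith
    -- Integrality gives `1 ≤ |c j 1|`, so the added `1` is absorbed: `4/3 + 1 = 7/3`, and `(7/3) /
    -- (2/3) = 7/2`.
    calc (|(comb c ζ 1 : ℝ)| + 1) / |(comb c ζ 0 : ℝ)|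
        ≤ (7 / 3 * |(c j 1 : ℝ)|) / (2 / 3 * |(c j 0 : ℝ)|) := by
          have := hc1 0
          have := hc1 1
          gcongr
          linarith
      _ = 7 / 2 * (|(c j 1 : ℝ)| / |(c j 0 : ℝ)|) := by ring
      _ ≤ 7 / 2 * (1 / 3 ^ s) := by gcongr
      _ = 7 / 2 / 3 ^ s := by ring

/-- This count is exactly offset by the factor `3⁻ˢ` in the slope bound. -/
lemma card_Lam_le (c : Fin s → Fin 2 → ℤ) : (Lam c).card ≤ 3 ^ s := by
  refine (Finset.card_erase_le.trans Finset.card_image_le).trans_eq ?_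
  rw [Finset.card_univ, Fintype.card_fun, Fintype.card_fin]
  rfl

end Frequencies

/-! ### Assembly. -/

/-- The term of `(ξ₂ / ξ₁) H¹` at the lattice point `q` as a tensor product. -/
noncomputable def ratioFactor (q : Fin 2 → ℤ) : Fin 2 → ℝ → ℂ :=
  ![cutoff (fun t => t⁻¹) (q 0), cutoff (fun t => t) (q 1)]

lemma ratioH_one_eq {s : ℕ} (c : Fin s → Fin 2 → ℤ) :
    ratioH c 1 = fun ξ => ∑ q ∈ Lam c, (1 / 2 ^ chi c q : ℂ) * ∏ i, ratioFactor q i (ξ i) := by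
  funext ξ
  rw [ratioH, H, Finset.mul_sum, Complex.ofReal_sum]
  refine Finset.sum_congr rfl fun q _ => ?_
  simp only [G, toPlane, ratioFactor, cutoff, Fin.prod_univ_two, PiLp.smul_apply, PiLp.sub_apply,
    smul_eq_mul, pow_one, Matrix.cons_val_zero, Matrix.cons_val_one]
  push_cast
  ring

end RieszBump

theorem mainTheorem4 :
    ∃ C : ℝ, ∀ s : ℕ, 1 ≤ s → ∃ θ : ℕ, 1 ≤ θ ∧
      ∀ (N : ℝ) (c : Fin s → Fin 2 → ℤ), 2 ≤ N → RieszBump.Admissible s N c →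
        Integrable (RieszBump.ratioH c θ) volume ∧
        Integrable (𝓕⁻ (RieszBump.ratioH c θ)) volume ∧
        ∫ x, ‖𝓕⁻ (RieszBump.ratioH c θ) x‖ ≤ C := by
  open RieszBump in
  -- Here `56 = 16 * (7/2)`: the constant of the reciprocal cut-off times that of the slope bound.
  refine ⟨(2 * Real.pi) ^ 2 * 56, fun s _ => ⟨1, le_rfl, fun N c hN hc => ?_⟩⟩
  have hinv : ∀ q ∈ Lam c, _ := fun q hq =>
    integrable_fourierInv_cutoff_inv (hc.slope_le hN hq).1
  have hid : ∀ q ∈ Lam c, _ := fun q _ => integrable_fourierInv_cutoff_id (q 1 : ℝ)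
  have hB : ∀ q ∈ Lam c, ∫ x, ‖𝓕⁻ (fun ξ : Plane => ∏ i, ratioFactor q i (ξ i)) x‖ ≤
      (2 * Real.pi) ^ 2 * 56 / 3 ^ s := by
    intro q hq
    rw [integral_norm_fourierInv_prod_coord, Fin.prod_univ_two]
    calc _ ≤ (2 * Real.pi * (16 / |(q 0 : ℝ)|)) * (2 * Real.pi * (|(q 1 : ℝ)| + 1)) :=
          mul_le_mul (hinv q hq).2.2 (hid q hq).2.2
            (integral_nonneg fun _ => norm_nonneg _) (by positivity)
      _ = (2 * Real.pi) ^ 2 * 16 * ((|(q 1 : ℝ)| + 1) / |(q 0 : ℝ)|) := by ring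
      _ ≤ (2 * Real.pi) ^ 2 * 16 * (7 / 2 / 3 ^ s) := by
          exact mul_le_mul_of_nonneg_left (hc.slope_le hN hq).2 (by positivity)
      _ = (2 * Real.pi) ^ 2 * 56 / 3 ^ s := by ring
  obtain ⟨h1, h2, h3⟩ := integral_norm_fourierInv_sum_le (S := Lam c)
    (w := fun q => (1 / 2 ^ chi c q : ℂ))
    (F := fun q (ξ : Plane) => ∏ i, ratioFactor q i (ξ i))
    (fun q _ => by
      rw [norm_div, norm_one, norm_pow, Complex.norm_ofNat]
      exact div_le_one_of_le₀ (one_le_pow₀ one_le_two) (by positivity))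
    (fun q hq => integrable_prod_coord fun i => by
      fin_cases i
      exacts [(hinv q hq).1, (hid q hq).1])
    (fun q hq => integrable_fourierInv_prod_coord fun i => by
      fin_cases i
      exacts [(hinv q hq).2.1, (hid q hq).2.1]) hB
  rw [ratioH_one_eq]
  refine ⟨h1, h2, h3.trans ?_⟩
  calc ((Lam c).card : ℝ) * ((2 * Real.pi) ^ 2 * 56 / 3 ^ s)
      ≤ 3 ^ s * ((2 * Real.pi) ^ 2 * 56 / 3 ^ s) := by
        gcongr
        exact_mod_cast card_Lam_le c
    _ = (2 * Real.pi) ^ 2 * 56 := by field_simp
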